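/- **Setting.** Let $P\ge 1$ and $0\le\mathcal O<P$ be integers. For each $n$ let $X=X_n$ be a non-stochastic $n\times P$ matrix with $\operatorname{rank}(X)=P$ whenever $n>P$, and suppose that $Q=\lim_{n\to\infty}X'X/n$ exists and is non-singular. For $\theta\in\mathbb R^P$ and $\sigma>0$ let $P_{n,\theta,\sigma}$ be the law of $Y=X\theta+u$ with $u\sim N(0,\sigma^2I_n)$. Let $c_{\mathcal O}=0$ and $0<c_p<\infty$ for $\mathcal O<p\le P$ be constants not depending on $n$ (the values $c_p$, $p<\mathcal O$, are irrelevant). For $0\le p\le P$ let $X[p]$ be the matrix of the first $p$ columns of $X$, and let $\tilde\theta(p)\in\mathbb R^P$ be the restricted least-squares estimator whose first $p$ components are $(X[p]'X[p])^{-1}X[p]'Y$ and whose other components are $0$. Put $\hat\sigma^2=(n-P)^{-1}(Y-X\tilde\theta(P))'(Y-X\tilde\theta(P))$ and, for $0<p\le P$, $$\xi_{n,p}=\Big(\big[(X[p]'X[p]/n)^{-1}\big]_{p,p}\Big)^{1/2},\qquad T_p=\frac{\sqrt n\,\tilde\theta_p(p)}{\hat\sigma\,\xi_{n,p}},\qquad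 T_p^*=\frac{\sqrt n\,\tilde\theta_p(p)}{\sigma\,\xi_{n,p}},\qquad T_0=T_0^*=0 .$$ Let $\hat p=\max\{p:|T_p|\ge c_p,\ 0\le p\le P\}$ and $\hat p^*=\max\{p:|T^*_p|\ge c_p,\ 0\le p\le P\}$, and let $\tilde\theta=\tilde\theta(\hat p)$ and $\tilde\theta^*=\tilde\theta(\hat p^*)$ be the corresponding post-model-selection estimators (unknown and known variance). Let $A$ be a non-stochastic $k\times P$ matrix of rank $k$, $1\le k\le P$, not depending on $n$. For $t\in\mathbb R^k$ (with componentwise inequalities) define the cdfs $$G_{n,\theta,\sigma}(t)=P_{n,\theta,\sigma}\big(\sqrt nA(\tilde\theta-\theta)\le t\big),\qquad G^*_{n,\theta,\sigma}(t)=P_{n,\theta,\sigma}\big(\sqrt nA(\tilde\theta^*-\theta)\le t\big),$$ and the model selection probabilities $\pi_{n,\theta,\sigma}(p)=P_{n,\theta,\sigma}(\hat p=p)$ and $\pi^*_{n,\theta,\sigma}(p)=P_{n,\theta,\sigma}(\hat p^*=p)$. For distribution functions $F,H$ of finite measures $\mu,\nu$ on $\mathbb R^k$ let $\|F-H\|_{TV}=\sup_B|\mu(B)-\nu(B)|$,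 the supremum over all Borel sets $B\subseteq\mathbb R^k$. **Theorem 4.2.** We have $$\sup_{\theta\in\mathbb R^P,\ \sigma>0}\big\|G_{n,\theta,\sigma}-G^*_{n,\theta,\sigma}\big\|_{TV}\xrightarrow{n\to\infty}0 .$$ Moreover, for each $p$ with $0\le p\le P$, $$\sup_{\theta\in\mathbb R^P,\ \sigma>0}\big|\pi_{n,\theta,\sigma}(p)-\pi^*_{n,\theta,\sigma}(p)\big|\xrightarrow{n\to\infty}0 .$$ -/

import Mathlib

open MeasureTheory ProbabilityTheory Filter Topology
open scoped ENNReal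

namespace PostSelection

noncomputable section

/-! ### Distribution functions on `ℝ^k` and their total variation distance -/

/-- The (not necessarily normalized) distribution function `t ↦ μ {z | z ≤ t}` of a measure on
`ℝ^k`; the order on `Fin k → ℝ` is the componentwise one. -/
def distFun {k : ℕ} (μ : Measure (Fin k → ℝ)) (t : Fin k → ℝ) : ℝ :=
  μ.real (Set.Iic t)

/-- A finite measure on `ℝ^k` is determined by its distribution function. -/
theorem eq_of_distFun_eq {k : ℕ} {μ ν : Measure (Fin k → ℝ)} [IsFiniteMeasure μ]
    [IsFiniteMeasure ν] (h : ∀ t, distFun μ t = distFun ν t) : μ = ν := by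
  have hgen : (MeasurableSpace.pi : MeasurableSpace (Fin k → ℝ)) =
      MeasurableSpace.generateFrom (Set.range Set.Iic) := by
    apply le_antisymm
    · refine iSup_le fun i => ?_
      rw [borel_eq_generateFrom_Iic ℝ |> (BorelSpace.measurable_eq (α := ℝ)).trans,
        MeasurableSpace.comap_generateFrom]
      refine MeasurableSpace.generateFrom_le ?_
      rintro _ ⟨_, ⟨a, rfl⟩, rfl⟩
      have : (fun x : Fin k → ℝ => x i) ⁻¹' Set.Iic a =
          ⋃ m : ℕ, Set.Iic (fun j => if j = i then a else (m : ℝ)) := by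
        ext x
        simp only [Set.mem_preimage, Set.mem_Iic, Set.mem_iUnion]
        constructor
        · intro hx
          obtain ⟨m, hm⟩ := exists_nat_ge (∑ j, |x j|)
          refine ⟨m, fun j => ?_⟩
          by_cases hj : j = i
          · subst hj; simpa using hx
          · simp only [hj, if_false]
            exact (le_abs_self _).trans ((Finset.single_le_sum
              (f := fun j => |x j|) (fun _ _ => abs_nonneg _) (Finset.mem_univ j)).trans hm)
        · rintro ⟨m, hm⟩
          simpa using hm i
      rw [this]
      exact MeasurableSet.iUnion fun m => MeasurableSpace.measurableSet_generateFrom ⟨_, rfl⟩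
    · refine MeasurableSpace.generateFrom_le ?_
      rintro _ ⟨a, rfl⟩
      exact measurableSet_Iic
  refine Measure.ext_of_generateFrom_of_iUnion (Set.range Set.Iic)
    (fun m : ℕ => Set.Iic (fun _ => (m : ℝ))) hgen ?_ ?_ (fun m => ⟨_, rfl⟩)
    (fun m => measure_ne_top μ _) ?_
  · rintro _ ⟨a, rfl⟩ _ ⟨b, rfl⟩ _
    exact ⟨a ⊓ b, Set.Iic_inter_Iic.symm⟩
  · refine Set.eq_univ_of_forall fun x => ?_
    obtain ⟨m, hm⟩ := exists_nat_ge (∑ j, |x j|)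
    refine Set.mem_iUnion.2 ⟨m, fun j => ?_⟩
    exact (le_abs_self _).trans ((Finset.single_le_sum
      (f := fun j => |x j|) (fun _ _ => abs_nonneg _) (Finset.mem_univ j)).trans hm)
  · rintro _ ⟨a, rfl⟩
    exact (measureReal_eq_measureReal_iff).1 (h a)

open Classical in
/-- The finite measure on `ℝ^k` whose distribution function is `F` (the zero measure if `F` is not
the distribution function of a finite measure). It is unique, see `measureOf_distFun`. -/
def measureOf {k : ℕ} (F : (Fin k → ℝ) → ℝ) : Measure (Fin k → ℝ) :=
  if h : ∃ μ : Measure (Fin k → ℝ), IsFiniteMeasure μ ∧ distFun μ = F then h.choose else 0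

theorem measureOf_distFun {k : ℕ} (μ : Measure (Fin k → ℝ)) [IsFiniteMeasure μ] :
    measureOf (distFun μ) = μ := by
  have h : ∃ ν : Measure (Fin k → ℝ), IsFiniteMeasure ν ∧ distFun ν = distFun μ :=
    ⟨μ, inferInstance, rfl⟩
  rw [measureOf, dif_pos h]
  have := h.choose_spec.1
  exact eq_of_distFun_eq (congrFun h.choose_spec.2)

/-- The total variation distance `‖F - H‖_TV` of two distribution functions on `ℝ^k`: the supremum
of `|μ B - ν B|` over Borel sets `B`, where `μ` and `ν` are the finite measures with distribution
functions `F` and `H`. -/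
def tvDist {k : ℕ} (F H : (Fin k → ℝ) → ℝ) : ℝ≥0∞ :=
  ⨆ (B : Set (Fin k → ℝ)) (_ : MeasurableSet B),
    ENNReal.ofReal |(measureOf F).real B - (measureOf H).real B|

/-! ### The linear regression model and the estimators

`X` is an `n × P` regressor matrix and `y` an observed response vector. Columns are numbered from
`0` in Lean, so "the first `p` columns" are those with index `< p`, and the `p`-th component of
a vector in `ℝ^P` has index `p - 1`. -/

/-- `P_{n,θ,σ}`: the law `N(Xθ, σ² I_n)` of `Y = Xθ + u`, `u ∼ N(0, σ² I_n)`, that is, the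
coordinates of `Y` are independent, the `i`-th one with law `N((Xθ)_i, σ²)`. -/
def sampleLaw {n P : ℕ} (X : Matrix (Fin n) (Fin P) ℝ) (θ : Fin P → ℝ) (σ : ℝ) :
    Measure (Fin n → ℝ) :=
  Measure.pi fun i => gaussianReal (X.mulVec θ i) (σ ^ 2).toNNReal

/-- `X[p]`: the matrix of the first `p` columns of `X`. -/
def firstCols {n P : ℕ} (X : Matrix (Fin n) (Fin P) ℝ) (p : ℕ) :
    Matrix (Fin n) {j : Fin P // (j : ℕ) < p} ℝ :=
  X.submatrix id Subtype.val

/-- The restricted least-squares estimator of order `p`: its first `p` components are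
`(X[p]'X[p])⁻¹ X[p]'y`, its last `P - p` components are `0`. -/
def restrictedLS {n P : ℕ} (X : Matrix (Fin n) (Fin P) ℝ) (p : ℕ) (y : Fin n → ℝ) :
    Fin P → ℝ := fun j =>
  if h : (j : ℕ) < p then
    (((firstCols X p).transpose * firstCols X p)⁻¹.mulVec
      ((firstCols X p).transpose.mulVec y)) ⟨j, h⟩
  else 0

/-- `σ̂ = ((n - P)⁻¹ (y - X θ̃(P))'(y - X θ̃(P)))^{1/2}`. -/
def sigmaHat {n P : ℕ} (X : Matrix (Fin n) (Fin P) ℝ) (y : Fin n → ℝ) : ℝ :=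
  Real.sqrt (((n : ℝ) - (P : ℝ))⁻¹ *
    ((y - X.mulVec (restrictedLS X P y)) ⬝ᵥ (y - X.mulVec (restrictedLS X P y))))

/-- `ξ_{n,p}`, the square root of the `p`-th diagonal element of `(X[p]'X[p]/n)⁻¹`
(for `0 < p ≤ P`). -/
def xi {n P : ℕ} (X : Matrix (Fin n) (Fin P) ℝ) (p : ℕ) (h : 0 < p ∧ p ≤ P) : ℝ :=
  Real.sqrt ((((n : ℝ)⁻¹ • ((firstCols X p).transpose * firstCols X p))⁻¹ :
      Matrix {j : Fin P // (j : ℕ) < p} {j : Fin P // (j : ℕ) < p} ℝ)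
    ⟨⟨p - 1, by omega⟩, by simp; omega⟩ ⟨⟨p - 1, by omega⟩, by simp; omega⟩)

/-- The test statistic `√n θ̃_p(p) / (s ξ_{n,p})` for `0 < p ≤ P`, and `0` for `p = 0`.
With `s = σ̂` this is `T_p`, with `s = σ` it is `T*_p`. -/
def testStat {n P : ℕ} (X : Matrix (Fin n) (Fin P) ℝ) (s : ℝ) (y : Fin n → ℝ) (p : ℕ) : ℝ :=
  if h : 0 < p ∧ p ≤ P then
    Real.sqrt n * restrictedLS X p y ⟨p - 1, by omega⟩ / (s * xi X p h)
  else 0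

/-- The model selector `max {p : |T_p| ≥ c_p, 0 ≤ p ≤ P}`, where the standard deviation `s` is used
in the test statistics. -/
def selector {n P : ℕ} (X : Matrix (Fin n) (Fin P) ℝ) (c : ℕ → ℝ) (s : ℝ) (y : Fin n → ℝ) : ℕ :=
  Nat.findGreatest (fun p => c p ≤ |testStat X s y p|) P

/-- `p̂`, the selector with estimated standard deviation. -/
def pHat {n P : ℕ} (X : Matrix (Fin n) (Fin P) ℝ) (c : ℕ → ℝ) (y : Fin n → ℝ) : ℕ :=
  selector X c (sigmaHat X y) y

/-- `p̂*`, the idealized selector, which knows `σ`. -/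
def pHatStar {n P : ℕ} (X : Matrix (Fin n) (Fin P) ℝ) (c : ℕ → ℝ) (σ : ℝ) (y : Fin n → ℝ) : ℕ :=
  selector X c σ y

/-- The post-model-selection estimator `θ̃`, equal to `θ̃(p)` on the event `p̂ = p`. -/
def thetaTilde {n P : ℕ} (X : Matrix (Fin n) (Fin P) ℝ) (c : ℕ → ℝ) (y : Fin n → ℝ) :
    Fin P → ℝ :=
  restrictedLS X (pHat X c y) y

/-- The idealized estimator `θ̃*`, equal to `θ̃(p)` on the event `p̂* = p`. -/
def thetaTildeStar {n P : ℕ} (X : Matrix (Fin n) (Fin P) ℝ) (c : ℕ → ℝ) (σ : ℝ)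
    (y : Fin n → ℝ) : Fin P → ℝ :=
  restrictedLS X (pHatStar X c σ y) y

/-- The cdf `G_{n,θ,σ}(t) = P_{n,θ,σ}(√n A(θ̃ - θ) ≤ t)`. -/
def G {n P k : ℕ} (X : Matrix (Fin n) (Fin P) ℝ) (c : ℕ → ℝ) (A : Matrix (Fin k) (Fin P) ℝ)
    (θ : Fin P → ℝ) (σ : ℝ) (t : Fin k → ℝ) : ℝ :=
  (sampleLaw X θ σ).real {y | Real.sqrt n • A.mulVec (thetaTilde X c y - θ) ≤ t}

/-- The cdf `G*_{n,θ,σ}(t) = P_{n,θ,σ}(√n A(θ̃* - θ) ≤ t)`. -/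
def GStar {n P k : ℕ} (X : Matrix (Fin n) (Fin P) ℝ) (c : ℕ → ℝ) (A : Matrix (Fin k) (Fin P) ℝ)
    (θ : Fin P → ℝ) (σ : ℝ) (t : Fin k → ℝ) : ℝ :=
  (sampleLaw X θ σ).real {y | Real.sqrt n • A.mulVec (thetaTildeStar X c σ y - θ) ≤ t}

/-- The model selection probability `π_{n,θ,σ}(p) = P_{n,θ,σ}(p̂ = p)`. -/
def selProb {n P : ℕ} (X : Matrix (Fin n) (Fin P) ℝ) (c : ℕ → ℝ)
    (θ : Fin P → ℝ) (σ : ℝ) (p : ℕ) : ℝ :=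
  (sampleLaw X θ σ).real {y | pHat X c y = p}

/-- The model selection probability `π*_{n,θ,σ}(p) = P_{n,θ,σ}(p̂* = p)`. -/
def selProbStar {n P : ℕ} (X : Matrix (Fin n) (Fin P) ℝ) (c : ℕ → ℝ)
    (θ : Fin P → ℝ) (σ : ℝ) (p : ℕ) : ℝ :=
  (sampleLaw X θ σ).real {y | pHatStar X c σ y = p}

end

end PostSelection

/-!
Both distances are at most `P(p̂ ≠ p̂*)`, because the two estimators, and the two selected orders,
coincide when the selectors agree (`tvDist_G_le`, `ofReal_abs_selProb_sub_le`). It remains to bound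
this probability uniformly in `θ` and `σ`; write `Y = Xθ + σz` with `z` standard normal.

The statistics satisfy `T_p = T*_p σ / σ̂`. If `|σ̂²/σ² - 1| ≤ δ < 1`, then the decisions
`|T_p| ≥ c_p` and `|T*_p| ≥ c_p` differ only if `|T*_p|` is within `c_p δ` of `c_p`; and since
`c_O = 0`, the selectors are determined by their decisions at the orders `p > O`
(`exists_near_of_selector_ne`).

* `T*_p` is normal with variance exactly `1`, whatever `θ` and `σ` are, so its density is bounded by
  `1` and it falls into such a window with probability `O(δ)` (`exists_testStat_eq_affine`,
  `stdNormal_abs_affine_le`). No bound on its mean is needed, and neither is any independence of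
  `σ̂` and `T*_p`.
* `(n - P) σ̂²/σ² = z'z - z'Hz` with the hat matrix `H`, which is free of `θ` and `σ`. Chebyshev's
  inequality controls `z'z`, and `z'Hz ≥ 0` has expectation `tr H = P`, so that Markov's inequality
  controls it. Hence `σ̂²/σ² → 1` in probability, uniformly (`stdNormal_sigmaHat_le`).

Letting `n → ∞` for fixed `δ`, and then `δ → 0`, gives `eventually_sampleLaw_ne_le`.
-/

namespace PostSelection

/-! ### The standard Gaussian vector -/

/-- The standard normal distribution `N(0, I_n)` on `ℝ^n`, as a product measure. -/
noncomputable def stdNormal (n : ℕ) : Measure (Fin n → ℝ) :=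
  Measure.pi fun _ => gaussianReal 0 1

instance (n : ℕ) : IsProbabilityMeasure (stdNormal n) := by
  unfold stdNormal; infer_instance

theorem integrable_mul_eval {n : ℕ} (i j : Fin n) :
    Integrable (fun z => z i * z j) (stdNormal n) := by
  have h : ∀ i : Fin n, MemLp (fun z : Fin n → ℝ => z i) 2 (stdNormal n) := fun i =>
    (memLp_id_gaussianReal' 2 (by simp)).comp_measurePreserving (measurePreserving_eval _ i)
  exact (h i).integrable_mul (h j)

theorem integral_sq_gaussianReal : ∫ x, x ^ 2 ∂(gaussianReal 0 1) = 1 := by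
  have h := variance_id_gaussianReal (μ := 0) (v := 1)
  rw [variance_eq_sub (memLp_id_gaussianReal' 2 (by simp))] at h
  simpa using h

theorem integral_mul_eval {n : ℕ} (i j : Fin n) :
    ∫ z, z i * z j ∂(stdNormal n) = if i = j then 1 else 0 := by
  split_ifs with hij
  · subst hij
    have := integral_comp_eval (μ := fun _ : Fin n => gaussianReal 0 1) (i := i)
      (f := fun x : ℝ => x ^ 2) (by fun_prop)
    simp only [← sq]
    exact this.trans integral_sq_gaussianReal
  · have hind : iIndepFun (fun (i : Fin n) (z : Fin n → ℝ) => z i) (stdNormal n) :=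
      iIndepFun_pi (X := fun _ x => x) fun _ => aemeasurable_id
    rw [(hind.indepFun hij).integral_fun_mul_eq_mul_integral
      (measurable_pi_apply i).aestronglyMeasurable (measurable_pi_apply j).aestronglyMeasurable]
    have := integral_comp_eval (μ := fun _ : Fin n => gaussianReal 0 1) (i := i)
      (f := fun x : ℝ => x) (by fun_prop)
    rw [stdNormal, this]
    simp

/-- A unit linear functional of a standard normal vector is a standard normal variable. -/
theorem map_dotProduct_stdNormal {n : ℕ} (v : Fin n → ℝ) (hv : v ⬝ᵥ v = 1) :
    (stdNormal n).map (fun z => v ⬝ᵥ z) = gaussianReal 0 1 := by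
  have hind : iIndepFun (fun (i : Fin n) (z : Fin n → ℝ) => z i) (stdNormal n) :=
    iIndepFun_pi (X := fun _ x => x) fun _ => aemeasurable_id
  have hg : HasGaussianLaw (fun (z : Fin n → ℝ) i => z i) (stdNormal n) := by
    refine iIndepFun.hasGaussianLaw (fun i => ⟨?_⟩) hind
    have : (stdNormal n).map (fun z => z i) = gaussianReal 0 1 :=
      (measurePreserving_eval (fun _ : Fin n => gaussianReal 0 1) i).map_eq
    rw [this]
    infer_instance
  have hL := hg.map_fun (∑ i, v i • (ContinuousLinearMap.proj i : (Fin n → ℝ) →L[ℝ] ℝ))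
  have heq : (fun z : Fin n → ℝ =>
      (∑ i, v i • (ContinuousLinearMap.proj i : (Fin n → ℝ) →L[ℝ] ℝ)) fun i => z i) =
      fun z => v ⬝ᵥ z := by
    ext z
    simp [dotProduct]
  rw [heq] at hL
  have hi : ∀ i : Fin n, Integrable (fun z => v i * z i) (stdNormal n) := fun i =>
    ((memLp_id_gaussianReal' 1 (by simp)).comp_measurePreserving
      (measurePreserving_eval _ i)).integrable (by simp) |>.const_mul _
  have hmean : ∫ z, v ⬝ᵥ z ∂(stdNormal n) = 0 := by
    simp only [dotProduct]
    rw [integral_finsetSum _ fun i _ => hi i]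
    refine Finset.sum_eq_zero fun i _ => ?_
    have := integral_comp_eval (μ := fun _ : Fin n => gaussianReal 0 1) (i := i)
      (f := fun x : ℝ => x) (by fun_prop)
    rw [integral_const_mul, stdNormal, this]
    simp
  have hvar : Var[fun z => v ⬝ᵥ z; stdNormal n] = 1 := by
    have hsum : (fun z : Fin n → ℝ => v ⬝ᵥ z) = ∑ i, fun z : Fin n → ℝ => v i * z i := by
      ext z; simp [dotProduct]
    rw [hsum, stdNormal, variance_sum_pi (X := fun i x => v i * x)]
    · rw [← hv]
      refine Finset.sum_congr rfl fun i _ => ?_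
      rw [variance_const_mul, variance_fun_id_gaussianReal, NNReal.coe_one, mul_one, sq]
    · exact fun i => (memLp_id_gaussianReal' 2 (by simp)).const_mul (v i)
  rw [hL.map_eq_gaussianReal, hmean, hvar]
  simp

/-- The density of `N(m, 1)` is bounded by `1`. -/
theorem gaussianReal_Icc_le (m a b : ℝ) :
    gaussianReal m 1 (Set.Icc a b) ≤ ENNReal.ofReal (b - a) := by
  rw [gaussianReal_apply _ one_ne_zero]
  calc ∫⁻ x in Set.Icc a b, gaussianPDF m 1 x
      ≤ ∫⁻ _ in Set.Icc a b, 1 := by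
        refine lintegral_mono fun x => ?_
        rw [gaussianPDF, ← ENNReal.ofReal_one]
        refine ENNReal.ofReal_le_ofReal ?_
        rw [gaussianPDFReal]
        refine mul_le_one₀ (inv_le_one_of_one_le₀ ?_) (Real.exp_pos _).le
          (Real.exp_le_one_iff.2 ?_)
        · rw [Real.one_le_sqrt]
          have := Real.pi_gt_three
          norm_num
          linarith
        · rw [neg_div]
          exact neg_nonpos.2 (by positivity)
    _ = ENNReal.ofReal (b - a) := by simp

theorem stdNormal_affine_Icc_le {n : ℕ} (v : Fin n → ℝ) (hv : v ⬝ᵥ v = 1) (m a b : ℝ) :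
    (stdNormal n) {z | m + v ⬝ᵥ z ∈ Set.Icc a b} ≤ ENNReal.ofReal (b - a) := by
  have hmeas : Measurable fun z : Fin n → ℝ => v ⬝ᵥ z := by unfold dotProduct; fun_prop
  have hset : {z : Fin n → ℝ | m + v ⬝ᵥ z ∈ Set.Icc a b} =
      (fun z => v ⬝ᵥ z) ⁻¹' Set.Icc (a - m) (b - m) := by
    ext z
    simp only [Set.mem_ofPred_eq, Set.mem_preimage, Set.mem_Icc, sub_le_iff_le_add',
      le_sub_iff_add_le']
  rw [hset, ← Measure.map_apply hmeas measurableSet_Icc, map_dotProduct_stdNormal v hv]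
  exact (gaussianReal_Icc_le 0 _ _).trans_eq (by ring_nf)

/-- Anti-concentration: the absolute value of a unit-variance normal variable is near `c` with small
probability, whatever the mean of the variable is. -/
theorem stdNormal_abs_affine_le {n : ℕ} (v : Fin n → ℝ) (hv : v ⬝ᵥ v = 1) (m c ε : ℝ) :
    (stdNormal n) {z | |(|m + v ⬝ᵥ z|) - c| ≤ ε} ≤ 2 * ENNReal.ofReal (2 * ε) := by
  have hsub : {z : Fin n → ℝ | |(|m + v ⬝ᵥ z|) - c| ≤ ε} ⊆
      {z | m + v ⬝ᵥ z ∈ Set.Icc (c - ε) (c + ε)} ∪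
        {z | m + v ⬝ᵥ z ∈ Set.Icc (-c - ε) (-c + ε)} := by
    intro z hz
    simp only [Set.mem_ofPred_eq, Set.mem_union, Set.mem_Icc, abs_le] at hz ⊢
    rcases abs_cases (m + v ⬝ᵥ z) with ⟨h, _⟩ | ⟨h, _⟩ <;> rw [h] at hz
    · exact Or.inl ⟨by linarith, by linarith⟩
    · exact Or.inr ⟨by linarith, by linarith⟩
  refine (measure_mono hsub).trans ((measure_union_le _ _).trans ?_)
  rw [two_mul]
  refine add_le_add ?_ ?_ <;>
    exact (stdNormal_affine_Icc_le v hv m _ _).trans_eq (by ring_nf)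

/-- Chebyshev's inequality for the chi-square variable `z'z`. -/
theorem stdNormal_dotProduct_self_le {n : ℕ} {ε : ℝ} (hε : 0 < ε) :
    (stdNormal n) {z | ε ≤ |z ⬝ᵥ z - n|} ≤
      ENNReal.ofReal (n * Var[fun x => x ^ 2; gaussianReal 0 1] / ε ^ 2) := by
  have hL4 : MemLp (fun x : ℝ => x ^ 2) 2 (gaussianReal 0 1) := by
    rw [memLp_two_iff_integrable_sq (by fun_prop)]
    have h := (memLp_id_gaussianReal' (μ := 0) (v := 1) 4 (by simp)).integrable_norm_pow
      (p := 4) (by simp)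
    refine h.congr (ae_of_all _ fun x => ?_)
    simp only [id, Real.norm_eq_abs]
    rw [← pow_mul, show 2 * 2 = 4 from rfl, pow_abs, abs_of_nonneg (by positivity)]
  have hsum : (fun z : Fin n → ℝ => z ⬝ᵥ z) = ∑ i, fun z : Fin n → ℝ => z i ^ 2 := by
    ext z; simp [dotProduct, sq]
  have hvar : Var[fun z => z ⬝ᵥ z; stdNormal n] =
      n * Var[fun x => x ^ 2; gaussianReal 0 1] := by
    rw [hsum, stdNormal, variance_sum_pi (X := fun _ x => x ^ 2) fun _ => hL4]
    simp
  have hmean : ∫ z, z ⬝ᵥ z ∂(stdNormal n) = n := by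
    simp only [dotProduct]
    rw [integral_finsetSum _ fun i _ => integrable_mul_eval i i]
    simp [integral_mul_eval]
  have hmem : MemLp (fun z : Fin n → ℝ => z ⬝ᵥ z) 2 (stdNormal n) := by
    rw [hsum]
    exact memLp_finsetSum' _ fun i _ =>
      hL4.comp_measurePreserving (measurePreserving_eval (fun _ : Fin n => gaussianReal 0 1) i)
  have := meas_ge_le_variance_div_sq hmem hε
  rwa [hmean, hvar] at this

/-- Markov's inequality for a non-negative quadratic form, whose expectation is its trace. -/
theorem stdNormal_quadForm_le {n : ℕ} (H : Matrix (Fin n) (Fin n) ℝ)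
    (hH : ∀ z, 0 ≤ z ⬝ᵥ H.mulVec z) {ε : ℝ} (hε : 0 < ε) :
    (stdNormal n) {z | ε ≤ z ⬝ᵥ H.mulVec z} ≤ ENNReal.ofReal (H.trace / ε) := by
  have hexp : (fun z : Fin n → ℝ => z ⬝ᵥ H.mulVec z) =
      fun z => ∑ i, ∑ j, H i j * (z i * z j) := by
    ext z
    simp only [dotProduct, Matrix.mulVec, Finset.mul_sum]
    exact Finset.sum_congr rfl fun i _ => Finset.sum_congr rfl fun j _ => by ring
  have hint : ∀ i j, Integrable (fun z => H i j * (z i * z j)) (stdNormal n) := fun i j =>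
    (integrable_mul_eval i j).const_mul _
  have hI : Integrable (fun z : Fin n → ℝ => z ⬝ᵥ H.mulVec z) (stdNormal n) := by
    rw [hexp]
    exact integrable_finsetSum _ fun i _ => integrable_finsetSum _ fun j _ => hint i j
  have hmean : ∫ z, z ⬝ᵥ H.mulVec z ∂(stdNormal n) = H.trace := by
    rw [hexp, integral_finsetSum _ fun i _ => integrable_finsetSum _ fun j _ => hint i j]
    simp only [Matrix.trace, Matrix.diag]
    refine Finset.sum_congr rfl fun i _ => ?_
    rw [integral_finsetSum _ fun j _ => hint i j]
    simp [integral_const_mul, integral_mul_eval]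
  have h := mul_meas_ge_le_integral_of_nonneg (ae_of_all _ hH) hI ε
  rw [hmean] at h
  rw [← ENNReal.ofReal_toReal (measure_ne_top (stdNormal n) {z | ε ≤ z ⬝ᵥ H.mulVec z})]
  refine ENNReal.ofReal_le_ofReal ?_
  rw [le_div_iff₀ hε, mul_comm]
  exact h

/-- The law of `Xθ + u`, `u ∼ N(0, σ² I_n)`, is the law of `Xθ + σz` with `z` standard normal. -/
theorem sampleLaw_eq_map {n P : ℕ} (X : Matrix (Fin n) (Fin P) ℝ) (θ : Fin P → ℝ) (σ : ℝ) :
    sampleLaw X θ σ = (stdNormal n).map fun z => X.mulVec θ + σ • z := by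
  have h1 : ∀ i, (gaussianReal 0 1).map (fun x => X.mulVec θ i + σ * x) =
      gaussianReal (X.mulVec θ i) (σ ^ 2).toNNReal := fun i => by
    rw [show (fun x => X.mulVec θ i + σ * x) = (fun x => X.mulVec θ i + x) ∘ fun x => σ * x from rfl,
      ← Measure.map_map (by fun_prop) (by fun_prop), gaussianReal_map_const_mul,
      gaussianReal_map_const_add]
    congr 1
    · simp
    · ext; simp [Real.coe_toNNReal _ (sq_nonneg σ)]
  have : ∀ i, SigmaFinite ((gaussianReal 0 1).map (fun x => X.mulVec θ i + σ * x)) := fun i => by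
    rw [h1]; infer_instance
  unfold sampleLaw stdNormal
  simp_rw [← h1]
  rw [← Measure.pi_map_pi fun i => by fun_prop]
  rfl

instance {n P : ℕ} (X : Matrix (Fin n) (Fin P) ℝ) (θ : Fin P → ℝ) (σ : ℝ) :
    IsProbabilityMeasure (sampleLaw X θ σ) := by
  unfold sampleLaw; infer_instance

end PostSelection

namespace PostSelection

/-! ### Least squares and the hat matrix -/

section HatMatrix

variable {n : ℕ} {ι : Type*} [Fintype ι] [DecidableEq ι]

/-- The hat matrix `F (F'F)⁻¹ F'`, the orthogonal projection onto the column space of `F` when `F`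
has full column rank. -/
noncomputable def hatMatrix (F : Matrix (Fin n) ι ℝ) : Matrix (Fin n) (Fin n) ℝ :=
  F * (F.transpose * F)⁻¹ * F.transpose

theorem transpose_hatMatrix (F : Matrix (Fin n) ι ℝ) :
    (hatMatrix F).transpose = hatMatrix F := by
  simp [hatMatrix, Matrix.transpose_mul, Matrix.transpose_nonsing_inv, Matrix.mul_assoc]

theorem hatMatrix_mul {F : Matrix (Fin n) ι ℝ} (hF : IsUnit (F.transpose * F).det) :
    hatMatrix F * F = F := by
  rw [hatMatrix, Matrix.mul_assoc, Matrix.mul_assoc, Matrix.nonsing_inv_mul _ hF, Matrix.mul_one]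

theorem hatMatrix_mul_self {F : Matrix (Fin n) ι ℝ} (hF : IsUnit (F.transpose * F).det) :
    hatMatrix F * hatMatrix F = hatMatrix F := by
  nth_rewrite 2 [hatMatrix]
  rw [← Matrix.mul_assoc, ← Matrix.mul_assoc, hatMatrix_mul hF, hatMatrix]

theorem trace_hatMatrix {F : Matrix (Fin n) ι ℝ} (hF : IsUnit (F.transpose * F).det) :
    (hatMatrix F).trace = Fintype.card ι := by
  rw [hatMatrix, Matrix.trace_mul_comm, ← Matrix.mul_assoc, Matrix.mul_nonsing_inv _ hF,
    Matrix.trace_one]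

theorem hatMatrix_mulVec_dotProduct_self {F : Matrix (Fin n) ι ℝ}
    (hF : IsUnit (F.transpose * F).det) (z : Fin n → ℝ) :
    (hatMatrix F).mulVec z ⬝ᵥ (hatMatrix F).mulVec z = z ⬝ᵥ (hatMatrix F).mulVec z := by
  rw [Matrix.dotProduct_mulVec, ← Matrix.mulVec_transpose, transpose_hatMatrix,
    Matrix.mulVec_mulVec, hatMatrix_mul_self hF, dotProduct_comm]

theorem dotProduct_hatMatrix_nonneg {F : Matrix (Fin n) ι ℝ}
    (hF : IsUnit (F.transpose * F).det) (z : Fin n → ℝ) :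
    0 ≤ z ⬝ᵥ (hatMatrix F).mulVec z := by
  rw [← hatMatrix_mulVec_dotProduct_self hF]
  exact Finset.sum_nonneg fun i _ => mul_self_nonneg _

/-- Pythagoras: the residual sum of squares is the total sum of squares minus the explained one. -/
theorem residual_dotProduct_self {F : Matrix (Fin n) ι ℝ}
    (hF : IsUnit (F.transpose * F).det) (z : Fin n → ℝ) :
    (z - (hatMatrix F).mulVec z) ⬝ᵥ (z - (hatMatrix F).mulVec z) =
      z ⬝ᵥ z - z ⬝ᵥ (hatMatrix F).mulVec z := by
  rw [sub_dotProduct, dotProduct_sub, dotProduct_sub, hatMatrix_mulVec_dotProduct_self hF,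
    dotProduct_comm ((hatMatrix F).mulVec z) z]
  ring

end HatMatrix

variable {n P : ℕ}

theorem firstCols_mulVec (X : Matrix (Fin n) (Fin P) ℝ) (p : ℕ)
    (u : {j : Fin P // (j : ℕ) < p} → ℝ) :
    (firstCols X p).mulVec u =
      X.mulVec fun j => if h : (j : ℕ) < p then u ⟨j, h⟩ else 0 := by
  ext i
  simp only [Matrix.mulVec, dotProduct]
  refine Fintype.sum_of_injective Subtype.val Subtype.val_injective _ _ ?_ ?_
  · intro j hj
    have : ¬ (j : ℕ) < p := fun h => hj ⟨⟨j, h⟩, rfl⟩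
    simp [this]
  · rintro ⟨j, hj⟩
    simp [firstCols, hj]

/-- The Gram matrix of the first `p` columns of a matrix of full column rank. -/
theorem posDef_gram_firstCols {X : Matrix (Fin n) (Fin P) ℝ} (hX : X.rank = P) (p : ℕ) :
    ((firstCols X p).transpose * firstCols X p).PosDef := by
  have hli : LinearIndependent ℝ X.col := by
    rw [linearIndependent_iff_card_eq_finrank_span, Fintype.card_fin, Set.finrank,
      ← Matrix.rank_eq_finrank_span_cols, hX]
  have hinj : Function.Injective (firstCols X p).mulVec :=
    Matrix.mulVec_injective_iff.2 (hli.comp Subtype.val Subtype.val_injective)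
  simpa using Matrix.PosDef.conjTranspose_mul_self _ hinj

theorem isUnit_det_gram_firstCols {X : Matrix (Fin n) (Fin P) ℝ} (hX : X.rank = P) (p : ℕ) :
    IsUnit ((firstCols X p).transpose * firstCols X p).det :=
  (Matrix.isUnit_iff_isUnit_det _).1 (posDef_gram_firstCols hX p).isUnit

theorem mulVec_restrictedLS (X : Matrix (Fin n) (Fin P) ℝ) (p : ℕ) (y : Fin n → ℝ) :
    X.mulVec (restrictedLS X p y) = (hatMatrix (firstCols X p)).mulVec y := by
  rw [hatMatrix, ← Matrix.mulVec_mulVec, ← Matrix.mulVec_mulVec, firstCols_mulVec]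
  rfl

/-- The variance estimator depends on the errors only; the unknown mean drops out. -/
theorem sigmaHat_sq {X : Matrix (Fin n) (Fin P) ℝ} (hX : X.rank = P) (hn : P < n)
    (θ : Fin P → ℝ) (σ : ℝ) (z : Fin n → ℝ) :
    sigmaHat X (X.mulVec θ + σ • z) ^ 2 =
      σ ^ 2 * ((z ⬝ᵥ z - z ⬝ᵥ (hatMatrix (firstCols X P)).mulVec z) / ((n : ℝ) - P)) := by
  have hF := isUnit_det_gram_firstCols hX P
  have hn' : (0 : ℝ) < (n : ℝ) - P := sub_pos.2 (by exact_mod_cast hn)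
  have hXθ : (hatMatrix (firstCols X P)).mulVec (X.mulVec θ) = X.mulVec θ := by
    have : X.mulVec θ = (firstCols X P).mulVec fun j => θ j := by
      rw [firstCols_mulVec]
      simp
    rw [this, Matrix.mulVec_mulVec, hatMatrix_mul hF]
  have hres : X.mulVec θ + σ • z - X.mulVec (restrictedLS X P (X.mulVec θ + σ • z)) =
      σ • (z - (hatMatrix (firstCols X P)).mulVec z) := by
    rw [mulVec_restrictedLS, Matrix.mulVec_add, hXθ, Matrix.mulVec_smul, smul_sub]
    abel
  rw [sigmaHat, Real.sq_sqrt, hres, smul_dotProduct, dotProduct_smul,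
    residual_dotProduct_self hF, smul_eq_mul, smul_eq_mul]
  · field_simp
  · exact mul_nonneg (inv_nonneg.2 hn'.le) (Finset.sum_nonneg fun i _ => mul_self_nonneg _)

/-- Under `N(Xθ, σ² I_n)` the statistic `T*_p` is normal with unit variance. -/
theorem exists_testStat_eq_affine {X : Matrix (Fin n) (Fin P) ℝ} (hX : X.rank = P) (hn : P < n)
    {p : ℕ} (hp : 0 < p ∧ p ≤ P) (θ : Fin P → ℝ) {σ : ℝ} (hσ : 0 < σ) :
    ∃ (m : ℝ) (v : Fin n → ℝ), v ⬝ᵥ v = 1 ∧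
      ∀ z, testStat X σ (X.mulVec θ + σ • z) p = m + v ⬝ᵥ z := by
  have hn0 : (0 : ℝ) < n := by exact_mod_cast (Nat.zero_le P).trans_lt hn
  set F := firstCols X p with hFdef
  have hF := isUnit_det_gram_firstCols hX p
  have hpos := posDef_gram_firstCols hX p
  rw [← hFdef] at hF hpos
  let q : {j : Fin P // (j : ℕ) < p} := ⟨⟨p - 1, by omega⟩, by simp; omega⟩
  set d : ℝ := (F.transpose * F)⁻¹ q q with hd
  have hd0 : 0 < d := hpos.inv.diag_pos
  -- The `p`-th component of the estimator is the linear functional `w`, of squared length `d`.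
  set w : Fin n → ℝ := ((F.transpose * F)⁻¹ * F.transpose) q with hw
  have hLS : ∀ y, restrictedLS X p y ⟨p - 1, by omega⟩ = w ⬝ᵥ y := fun y => by
    have hlt : p - 1 < p := by omega
    rw [restrictedLS, dif_pos hlt, Matrix.mulVec_mulVec]
    rfl
  have hww : w ⬝ᵥ w = d := by
    have : w ⬝ᵥ w = (((F.transpose * F)⁻¹ * F.transpose) *
        ((F.transpose * F)⁻¹ * F.transpose).transpose) q q := rfl
    rw [this, Matrix.transpose_mul, Matrix.transpose_transpose, Matrix.transpose_nonsing_inv,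
      Matrix.transpose_mul, Matrix.transpose_transpose, Matrix.mul_assoc,
      ← Matrix.mul_assoc F.transpose, Matrix.mul_nonsing_inv _ hF, Matrix.mul_one]
  have hxi : xi X p hp = Real.sqrt n * Real.sqrt d := by
    rw [xi, ← Real.sqrt_mul hn0.le]
    congr 1
    have hinv : ((n : ℝ)⁻¹ • (F.transpose * F))⁻¹ = (n : ℝ) • (F.transpose * F)⁻¹ := by
      refine Matrix.inv_eq_left_inv ?_
      rw [Matrix.smul_mul, Matrix.mul_smul, Matrix.nonsing_inv_mul _ hF, smul_smul,
        mul_inv_cancel₀ hn0.ne', one_smul]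
    rw [← hFdef, hinv]
    rfl
  have hsn : Real.sqrt n ≠ 0 := (Real.sqrt_pos.2 hn0).ne'
  have hsd : Real.sqrt d ≠ 0 := (Real.sqrt_pos.2 hd0).ne'
  refine ⟨w ⬝ᵥ X.mulVec θ / (σ * Real.sqrt d), (Real.sqrt d)⁻¹ • w, ?_, fun z => ?_⟩
  · rw [smul_dotProduct, dotProduct_smul, hww, smul_eq_mul, smul_eq_mul]
    nth_rewrite 3 [← Real.mul_self_sqrt hd0.le]
    field_simp
  · rw [testStat, dif_pos hp, hLS, hxi, dotProduct_add, dotProduct_smul, smul_dotProduct,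
      smul_eq_mul, smul_eq_mul]
    field_simp

/-! ### When the two selectors disagree -/

theorem testStat_mul_eq (X : Matrix (Fin n) (Fin P) ℝ) {s σ : ℝ} (hs : 0 < s) (hσ : 0 < σ)
    (y : Fin n → ℝ) (p : ℕ) :
    |testStat X s y p| * (s / σ) = |testStat X σ y p| := by
  have hr : 0 < s / σ := div_pos hs hσ
  rw [← abs_of_pos hr, ← abs_mul]
  congr 1
  unfold testStat
  split_ifs
  · field_simp
  · simp

/-- Two selectors whose decisions agree at all orders above `O` are equal, as the order `O`
is never rejected. -/
theorem selector_eq_of_iff (X : Matrix (Fin n) (Fin P) ℝ) {c : ℕ → ℝ} {O : ℕ} (hO : O ≤ P)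
    (hcO : c O = 0) {s σ : ℝ} {y : Fin n → ℝ}
    (h : ∀ p, O < p → p ≤ P → (c p ≤ |testStat X s y p| ↔ c p ≤ |testStat X σ y p|)) :
    selector X c s y = selector X c σ y := by
  have hOle : ∀ s, c O ≤ |testStat X s y O| := fun s => hcO ▸ abs_nonneg _
  have hge : O ≤ selector X c σ y := Nat.le_findGreatest hO (hOle σ)
  have hspec : c (selector X c σ y) ≤ |testStat X σ y (selector X c σ y)| :=
    Nat.findGreatest_spec (P := fun p => c p ≤ |testStat X σ y p|) hO (hOle σ)
  have hleP : selector X c σ y ≤ P := Nat.findGreatest_le P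
  refine Nat.findGreatest_eq_iff.2 ⟨hleP, fun _ => ?_, fun p hp hpP hcp => ?_⟩
  · rcases hge.eq_or_lt with he | hlt
    · rw [← he]
      exact hOle s
    · exact (h _ hlt hleP).2 hspec
  · exact Nat.findGreatest_is_greatest hp hpP ((h p (hge.trans_lt hp) hpP).1 hcp)

/-- If `s` is close to `σ`, the selectors based on `s` and on `σ` can only disagree when a statistic
based on `σ` is close to its critical value. -/
theorem exists_near_of_selector_ne (X : Matrix (Fin n) (Fin P) ℝ) {c : ℕ → ℝ} {O : ℕ}
    (hO : O ≤ P) (hcO : c O = 0) (hc : ∀ p, O < p → p ≤ P → 0 < c p) {s σ δ : ℝ}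
    (hs : 0 ≤ s) (hσ : 0 < σ) (hδ : δ < 1) (hsσ : |s ^ 2 / σ ^ 2 - 1| ≤ δ) {y : Fin n → ℝ}
    (hne : selector X c s y ≠ selector X c σ y) :
    ∃ p ∈ Finset.Ioc O P, |(|testStat X σ y p|) - c p| ≤ c p * δ := by
  by_contra! hfar
  refine hne (selector_eq_of_iff X hO hcO fun p hp hpP => ?_)
  have hcp := hc p hp hpP
  have hs0 : 0 < s := by
    refine hs.lt_of_ne fun h => ?_
    rw [← h] at hsσ
    norm_num at hsσ
    linarith
  have hr : 0 < s / σ := div_pos hs0 hσ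
  have hr1 : |s / σ - 1| ≤ δ := by
    have hfac : s ^ 2 / σ ^ 2 - 1 = (s / σ - 1) * (s / σ + 1) := by rw [← div_pow]; ring
    rw [hfac, abs_mul, abs_of_pos (by linarith : 0 < s / σ + 1)] at hsσ
    exact (le_mul_of_one_le_right (abs_nonneg _) (by linarith)).trans hsσ
  have hfarp := hfar p (Finset.mem_Ioc.2 ⟨hp, hpP⟩)
  rw [← mul_le_mul_iff_left₀ hr, testStat_mul_eq X hs0 hσ]
  rw [abs_le] at hr1
  rcases lt_abs.1 hfarp with h | h
  · exact ⟨fun _ => by nlinarith, fun _ => by nlinarith⟩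
  · exact ⟨fun _ => by nlinarith, fun _ => by nlinarith⟩

end PostSelection

namespace PostSelection

/-! ### Total variation distance of the two estimators -/

/-- Two events that coincide off `D` have probabilities differing by at most that of `D`. -/
theorem ofReal_abs_measureReal_sub_le {α : Type*} {mα : MeasurableSpace α} (μ : Measure α)
    [IsFiniteMeasure μ] {S T D : Set α} (hST : S ⊆ T ∪ D) (hTS : T ⊆ S ∪ D) :
    ENNReal.ofReal |μ.real S - μ.real T| ≤ μ D := by
  rw [← ENNReal.ofReal_toReal (measure_ne_top μ D)]
  refine ENNReal.ofReal_le_ofReal (abs_sub_le_iff.2 ⟨?_, ?_⟩)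
  · have := (measureReal_mono (μ := μ) hST).trans (measureReal_union_le T D)
    simp only [Measure.real] at this ⊢
    linarith
  · have := (measureReal_mono (μ := μ) hTS).trans (measureReal_union_le S D)
    simp only [Measure.real] at this ⊢
    linarith

/-- The coupling inequality for total variation. -/
theorem tvDist_map_le {α : Type*} {mα : MeasurableSpace α} (μ : Measure α) [IsFiniteMeasure μ]
    {k : ℕ} {f g : α → Fin k → ℝ} (hf : Measurable f) (hg : Measurable g) {D : Set α}
    (hD : ∀ x, x ∉ D → f x = g x) :
    tvDist (fun t => μ.real {x | f x ≤ t}) (fun t => μ.real {x | g x ≤ t}) ≤ μ D := by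
  have hdist : ∀ f : α → Fin k → ℝ, Measurable f →
      (fun t => μ.real {x | f x ≤ t}) = distFun (μ.map f) := fun f hf => by
    ext t
    rw [distFun, map_measureReal_apply hf measurableSet_Iic]
    rfl
  rw [hdist f hf, hdist g hg, tvDist, measureOf_distFun, measureOf_distFun]
  refine iSup₂_le fun B hB => ?_
  rw [map_measureReal_apply hf hB, map_measureReal_apply hg hB]
  refine ofReal_abs_measureReal_sub_le μ (fun x hx => ?_) fun x hx => ?_
  · by_cases hxD : x ∈ D
    · exact Or.inr hxD
    · exact Or.inl (by rwa [Set.mem_preimage, ← hD x hxD])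
  · by_cases hxD : x ∈ D
    · exact Or.inr hxD
    · exact Or.inl (by rwa [Set.mem_preimage, hD x hxD])

variable {n P : ℕ}

theorem measurable_mulVec {m l : Type*} [Fintype l] (A : Matrix m l ℝ) :
    Measurable fun v : l → ℝ => A.mulVec v := by
  unfold Matrix.mulVec dotProduct
  fun_prop

theorem measurable_restrictedLS (X : Matrix (Fin n) (Fin P) ℝ) (p : ℕ) :
    Measurable (restrictedLS X p) := by
  refine measurable_pi_lambda _ fun j => ?_
  unfold restrictedLS
  split_ifs with h
  · exact (measurable_pi_apply _).comp ((measurable_mulVec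
      ((firstCols X p).transpose * firstCols X p)⁻¹).comp
        (measurable_mulVec (firstCols X p).transpose))
  · exact measurable_const

theorem measurable_sigmaHat (X : Matrix (Fin n) (Fin P) ℝ) : Measurable (sigmaHat X) := by
  have h := measurable_restrictedLS X P
  unfold sigmaHat dotProduct
  have hr : Measurable fun y : Fin n → ℝ => y - X.mulVec (restrictedLS X P y) :=
    measurable_id.sub ((measurable_mulVec X).comp h)
  refine (Measurable.const_mul ?_ _).sqrt
  exact Finset.measurable_sum _ fun i _ =>
    ((measurable_pi_apply i).comp hr).mul ((measurable_pi_apply i).comp hr)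

theorem measurable_selector (X : Matrix (Fin n) (Fin P) ℝ) (c : ℕ → ℝ) {s : (Fin n → ℝ) → ℝ}
    (hs : Measurable s) : Measurable fun y => selector X c (s y) y := by
  unfold selector
  refine measurable_findGreatest fun p _ => measurableSet_le measurable_const ?_
  unfold testStat
  split_ifs with h
  · have := (measurable_pi_apply ⟨p - 1, by omega⟩).comp (measurable_restrictedLS X p)
    exact ((this.const_mul _).div (hs.mul_const _)).norm
  · simp

theorem measurable_restrictedLS_comp (X : Matrix (Fin n) (Fin P) ℝ) {q : (Fin n → ℝ) → ℕ}
    (hq : Measurable q) : Measurable fun y => restrictedLS X (q y) y := by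
  have h : Measurable fun a : ℕ × (Fin n → ℝ) => restrictedLS X a.1 a.2 :=
    measurable_from_prod_countable_right fun p => measurable_restrictedLS X p
  exact h.comp (hq.prodMk measurable_id)

theorem tvDist_G_le {k : ℕ} (X : Matrix (Fin n) (Fin P) ℝ) (c : ℕ → ℝ)
    (A : Matrix (Fin k) (Fin P) ℝ) (θ : Fin P → ℝ) (σ : ℝ) :
    tvDist (G X c A θ σ) (GStar X c A θ σ) ≤
      sampleLaw X θ σ {y | pHat X c y ≠ pHatStar X c σ y} := by
  have hmeas : ∀ {q : (Fin n → ℝ) → ℕ}, Measurable q →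
      Measurable fun y => Real.sqrt n • A.mulVec (restrictedLS X (q y) y - θ) := fun hq =>
    ((measurable_mulVec A).comp ((measurable_restrictedLS_comp X hq).sub_const θ)).const_smul
      (Real.sqrt n)
  refine tvDist_map_le _ (hmeas (measurable_selector X c (measurable_sigmaHat X)))
    (hmeas (measurable_selector X c measurable_const)) fun y hy => ?_
  have hy : pHat X c y = pHatStar X c σ y := not_not.1 hy
  simp only [pHat, pHatStar] at hy
  rw [hy]

theorem ofReal_abs_selProb_sub_le (X : Matrix (Fin n) (Fin P) ℝ) (c : ℕ → ℝ)
    (θ : Fin P → ℝ) (σ : ℝ) (p : ℕ) :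
    ENNReal.ofReal |selProb X c θ σ p - selProbStar X c θ σ p| ≤
      sampleLaw X θ σ {y | pHat X c y ≠ pHatStar X c σ y} := by
  refine ofReal_abs_measureReal_sub_le _ (fun y hy => ?_) fun y hy => ?_
  · by_cases h : pHat X c y = pHatStar X c σ y
    · exact Or.inl (h.symm.trans hy)
    · exact Or.inr h
  · by_cases h : pHat X c y = pHatStar X c σ y
    · exact Or.inl (h.trans hy)
    · exact Or.inr h

/-! ### Uniform convergence -/

/-- The law of `σ̂²/σ²` is concentrated near `1`, uniformly in `θ`, `σ` and the regressors. -/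
theorem stdNormal_sigmaHat_le {X : Matrix (Fin n) (Fin P) ℝ} (hX : X.rank = P) (hn : P < n)
    {δ : ℝ} (hδn : (P : ℝ) < δ * (n - P) / 2) (θ : Fin P → ℝ) {σ : ℝ} (hσ : 0 < σ) :
    stdNormal n {z | δ < |sigmaHat X (X.mulVec θ + σ • z) ^ 2 / σ ^ 2 - 1|} ≤
      ENNReal.ofReal (n * Var[fun x => x ^ 2; gaussianReal 0 1] / (δ * (n - P) / 2) ^ 2) +
        ENNReal.ofReal (P / (δ * (n - P) / 2)) := by
  set ε : ℝ := δ * (n - P) / 2 with hε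
  have hn' : (0 : ℝ) < (n : ℝ) - P := sub_pos.2 (by exact_mod_cast hn)
  have hε0 : 0 < ε := (Nat.cast_nonneg P).trans_lt hδn
  have hF := isUnit_det_gram_firstCols hX P
  set H := hatMatrix (firstCols X P)
  have htr : H.trace = P := by
    rw [trace_hatMatrix hF]
    simp
  have hsub : {z | δ < |sigmaHat X (X.mulVec θ + σ • z) ^ 2 / σ ^ 2 - 1|} ⊆
      {z | ε ≤ |z ⬝ᵥ z - n|} ∪ {z | ε ≤ z ⬝ᵥ H.mulVec z} := by
    intro z hz
    by_contra hcon
    simp only [Set.mem_union, Set.mem_ofPred_eq, not_or, not_le] at hcon hz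
    obtain ⟨h1, h2⟩ := hcon
    have h0 : 0 ≤ z ⬝ᵥ H.mulVec z := dotProduct_hatMatrix_nonneg hF z
    rw [sigmaHat_sq hX hn, mul_div_cancel_left₀ _ (pow_pos hσ 2).ne', div_sub_one hn'.ne',
      abs_div, abs_of_pos hn', lt_div_iff₀ hn'] at hz
    rw [abs_lt] at h1
    have h3 : δ * (n - P) = 2 * ε := by rw [hε]; ring
    rw [h3] at hz
    -- `z'z` and `z'Hz` are within `ε` of `n` and `P`: for the latter, `0 ≤ z'Hz < ε` and `P < ε`.
    rcases lt_abs.1 hz with h | h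
    · linarith
    · linarith
  refine (measure_mono hsub).trans ((measure_union_le _ _).trans ?_)
  rw [← htr]
  exact add_le_add (stdNormal_dotProduct_self_le hε0)
    (stdNormal_quadForm_le H (dotProduct_hatMatrix_nonneg hF) hε0)

/-- An explicit bound, free of `θ` and `σ`, on the probability that the selectors disagree. -/
theorem sampleLaw_ne_le {X : Matrix (Fin n) (Fin P) ℝ} (hX : X.rank = P) (hn : P < n) {O : ℕ}
    (hO : O ≤ P) {c : ℕ → ℝ} (hcO : c O = 0) (hc : ∀ p, O < p → p ≤ P → 0 < c p) {δ : ℝ}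
    (hδ : δ < 1) (hδn : (P : ℝ) < δ * (n - P) / 2) (θ : Fin P → ℝ) {σ : ℝ} (hσ : 0 < σ) :
    sampleLaw X θ σ {y | pHat X c y ≠ pHatStar X c σ y} ≤
      (ENNReal.ofReal (n * Var[fun x => x ^ 2; gaussianReal 0 1] / (δ * (n - P) / 2) ^ 2) +
        ENNReal.ofReal (P / (δ * (n - P) / 2))) +
      ∑ p ∈ Finset.Ioc O P, 2 * ENNReal.ofReal (2 * (c p * δ)) := by
  have hmeas : MeasurableSet {y | pHat X c y ≠ pHatStar X c σ y} :=
    (measurableSet_eq_fun (measurable_selector X c (measurable_sigmaHat X))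
      (measurable_selector X c measurable_const)).compl
  rw [sampleLaw_eq_map, Measure.map_apply (by fun_prop) hmeas]
  have hsub : (fun z : Fin n → ℝ => X.mulVec θ + σ • z) ⁻¹'
      {y | pHat X c y ≠ pHatStar X c σ y} ⊆
      {z | δ < |sigmaHat X (X.mulVec θ + σ • z) ^ 2 / σ ^ 2 - 1|} ∪
        ⋃ p ∈ Finset.Ioc O P,
          {z | |(|testStat X σ (X.mulVec θ + σ • z) p|) - c p| ≤ c p * δ} := by
    intro z hz
    by_cases h : |sigmaHat X (X.mulVec θ + σ • z) ^ 2 / σ ^ 2 - 1| ≤ δ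
    · obtain ⟨p, hp, hle⟩ :=
        exists_near_of_selector_ne X hO hcO hc (Real.sqrt_nonneg _) hσ hδ h hz
      exact Or.inr (Set.mem_biUnion hp hle)
    · exact Or.inl (not_le.1 h)
  refine (measure_mono hsub).trans ((measure_union_le _ _).trans (add_le_add
    (stdNormal_sigmaHat_le hX hn hδn θ hσ) ((measure_biUnion_finset_le _ _).trans
      (Finset.sum_le_sum fun p hp => ?_))))
  have hp := Finset.mem_Ioc.1 hp
  obtain ⟨m, v, hv, hT⟩ := exists_testStat_eq_affine hX hn ⟨by omega, hp.2⟩ θ hσ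
  simp only [hT]
  exact stdNormal_abs_affine_le v hv m _ _

/-- The two selectors agree with probability tending to `1`, uniformly in `θ` and `σ`. -/
theorem eventually_sampleLaw_ne_le {O : ℕ} (hO : O ≤ P) (X : (n : ℕ) → Matrix (Fin n) (Fin P) ℝ)
    (hX : ∀ n, P < n → (X n).rank = P) {c : ℕ → ℝ} (hcO : c O = 0)
    (hc : ∀ p, O < p → p ≤ P → 0 < c p) {ε : ℝ≥0∞} (hε : 0 < ε) :
    ∀ᶠ n in atTop, ∀ (θ : Fin P → ℝ) (σ : ℝ), 0 < σ →
      sampleLaw (X n) θ σ {y | pHat (X n) c y ≠ pHatStar (X n) c σ y} ≤ ε := by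
  have hε2 : 0 < ε / 2 := ENNReal.half_pos hε.ne'
  -- Choose the tolerance `δ` for `σ̂²/σ²` first, to control the anti-concentration terms.
  obtain ⟨δ, ⟨hδ0, hδ1⟩, hδ⟩ : ∃ δ ∈ Set.Ioo (0 : ℝ) 1,
      ∑ p ∈ Finset.Ioc O P, 2 * ENNReal.ofReal (2 * (c p * δ)) ≤ ε / 2 := by
    have hlim : Tendsto (fun δ : ℝ => ∑ p ∈ Finset.Ioc O P, 2 * ENNReal.ofReal (2 * (c p * δ)))
        (𝓝[>] 0) (𝓝 0) := by
      have hcont : Continuous fun δ : ℝ =>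
          ∑ p ∈ Finset.Ioc O P, 2 * ENNReal.ofReal (2 * (c p * δ)) :=
        continuous_finsetSum _ fun p _ =>
          (ENNReal.continuous_const_mul (by simp)).comp
            (ENNReal.continuous_ofReal.comp (by fun_prop))
      simpa using (hcont.tendsto 0).mono_left nhdsWithin_le_nhds
    obtain ⟨δ, h1, h2⟩ := ((ENNReal.tendsto_nhds_zero.1 hlim _ hε2).and
      (Ioo_mem_nhdsGT (zero_lt_one' ℝ))).exists
    exact ⟨δ, h2, h1⟩
  have hden : Tendsto (fun n : ℕ => δ * ((n : ℝ) - P) / 2) atTop atTop :=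
    ((tendsto_atTop_add_const_right _ _ tendsto_natCast_atTop_atTop).const_mul_atTop
      hδ0).atTop_div_const two_pos
  have hlim : Tendsto (fun n : ℕ =>
      ENNReal.ofReal (n * Var[fun x => x ^ 2; gaussianReal 0 1] / (δ * (n - P) / 2) ^ 2) +
        ENNReal.ofReal (P / (δ * (n - P) / 2))) atTop (𝓝 0) := by
    have h2 := tendsto_const_nhds (x := (P : ℝ)).div_atTop hden
    have hratio : Tendsto (fun n : ℕ => (n : ℝ) / (δ * (n - P) / 2)) atTop (𝓝 (2 / δ)) := by
      have h1 : Tendsto (fun n : ℕ => 2 / δ + (2 * P / δ) / ((n : ℝ) - P)) atTop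
          (𝓝 (2 / δ + 0)) :=
        tendsto_const_nhds.add (tendsto_const_nhds.div_atTop
          (tendsto_atTop_add_const_right _ _ tendsto_natCast_atTop_atTop))
      rw [add_zero] at h1
      refine h1.congr' ?_
      filter_upwards [eventually_gt_atTop P] with n hn
      have : (n : ℝ) - P ≠ 0 := sub_ne_zero.2 (by exact_mod_cast hn.ne')
      field_simp
      ring
    have h1 : Tendsto (fun n : ℕ =>
        n * Var[fun x => x ^ 2; gaussianReal 0 1] / (δ * (n - P) / 2) ^ 2) atTop (𝓝 0) := by
      have h3 := (hratio.mul_const Var[fun x => x ^ 2; gaussianReal 0 1]).div_atTop hden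
      refine h3.congr fun n => ?_
      rw [sq, div_mul_eq_mul_div, div_div]
    simpa using (ENNReal.tendsto_ofReal h1).add (ENNReal.tendsto_ofReal h2)
  filter_upwards [ENNReal.tendsto_nhds_zero.1 hlim _ hε2, eventually_gt_atTop P,
    hden.eventually_gt_atTop (P : ℝ)] with n hn1 hn2 hn3 θ σ hσ
  calc _ ≤ _ := sampleLaw_ne_le (hX n hn2) hn2 hO hcO hc hδ1 hn3 θ hσ
    _ ≤ ε / 2 + ε / 2 := add_le_add hn1 hδ
    _ = ε := ENNReal.add_halves ε

end PostSelection

theorem theorem4p2 {P k O : ℕ} (hO : O < P)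
    (X : (n : ℕ) → Matrix (Fin n) (Fin P) ℝ)
    (hX : ∀ n, P < n → (X n).rank = P)
    (Q : Matrix (Fin P) (Fin P) ℝ)
    (hQ : Tendsto (fun n : ℕ => (n : ℝ)⁻¹ • ((X n).transpose * X n)) atTop (𝓝 Q))
    (hQdet : IsUnit Q.det)
    (c : ℕ → ℝ) (hcO : c O = 0) (hc : ∀ p, O < p → p ≤ P → 0 < c p)
    (A : Matrix (Fin k) (Fin P) ℝ) (hk : 1 ≤ k) (hA : A.rank = k) :
    Tendsto (fun n : ℕ => ⨆ (θ : Fin P → ℝ) (σ : ℝ) (_ : 0 < σ),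
        PostSelection.tvDist (PostSelection.G (X n) c A θ σ)
          (PostSelection.GStar (X n) c A θ σ)) atTop (𝓝 0) ∧
    ∀ p : ℕ, p ≤ P →
      Tendsto (fun n : ℕ => ⨆ (θ : Fin P → ℝ) (σ : ℝ) (_ : 0 < σ),
        ENNReal.ofReal |PostSelection.selProb (X n) c θ σ p -
          PostSelection.selProbStar (X n) c θ σ p|) atTop (𝓝 0) := by
  refine ⟨ENNReal.tendsto_nhds_zero.2 fun ε hε => ?_,
    fun p _ => ENNReal.tendsto_nhds_zero.2 fun ε hε => ?_⟩ <;>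
  filter_upwards [PostSelection.eventually_sampleLaw_ne_le hO.le X hX hcO hc hε] with n hn
  · exact iSup_le fun θ => iSup₂_le fun σ hσ =>
      (PostSelection.tvDist_G_le (X n) c A θ σ).trans (hn θ σ hσ)
  · exact iSup_le fun θ => iSup₂_le fun σ hσ =>
      (PostSelection.ofReal_abs_selProb_sub_le (X n) c θ σ p).trans (hn θ σ hσ)
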